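/- Fix an integer $d\ge 0$, and let $Gr_d$ be the class of all countable simple graphs (finite or infinite, not necessarily connected) in which every vertex has at most $d$ neighbours. For a vertex $x$ of a graph $G$ let $B^G_r(x)$ be the subgraph induced on the vertices at distance at most $r$ from $x$, rooted at $x$. Property A: a graph $G$ is of Property A if for every $\varepsilon>0$ there are an integer $r>1$ and a map $\Theta$ from $V(G)$ to the probability measures on $V(G)$ such that $\operatorname{supp}\Theta(x)\subseteq B^G_r(x)$ for every $x\in V(G)$, and $\|\Theta(x)-\Theta(y)\|_1<\varepsilon$ for all adjacent $x,y$. A sequence $\{G_n\}_{n=1}^\infty$ of graphs is of Property A if the disjoint union of the graphs $G_n$ is of Property A. Neighborhood distance: let $\hat G$ be the set of all pairs (radius $r\ge 0$, rooted-isomorphism class of $B^G_r(x)$), $x\in V(G)$, and let $B_1,B_2,\dots$ be an enumeration of all such pairs that occur for graphs in $Gr_d$. For $G,H\in Gr_d$ put $\operatorname{dist}(G,H)=0$ if $\hat G=\hat H$, and otherwise $\operatorname{dist}(G,H)=2^{-n}$, where $n$ is the least index such that $B_n$ belongs to exactly one of $\hat G$, $\hat H$. Laplacian: for $G\in Gr_d$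 let $\mathcal L_G:\ell^2(V(G))\to\ell^2(V(G))$ be the bounded operator $\mathcal L_G(f)(x)=\deg(x)f(x)-\sum_{y\sim x}f(y)$. Theorem. Let $\{G_n\}_{n=1}^\infty\subset Gr_d$ be of Property A as a sequence, let $G\in Gr_d$, and suppose that $\operatorname{dist}(G_n,G)\to 0$. Then $\operatorname{Spec}(\mathcal L_{G_n})\to\operatorname{Spec}(\mathcal L_G)$ in the Hausdorff distance. -/

import Mathlib

open Filter Topology
open scoped ENNReal

namespace BoundedDegree

/-! ### Graphs of vertex degree bound `d` -/

/-- Every vertex of `G` has at most `d` neighbours (in particular finitely many). -/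
def DegreeLE {V : Type*} (G : SimpleGraph V) (d : ℕ) : Prop :=
  ∀ x : V, (G.neighborSet x).encard ≤ d

theorem DegreeLE.finite {V : Type*} {G : SimpleGraph V} {d : ℕ} (hG : DegreeLE G d) (x : V) :
    (G.neighborSet x).Finite :=
  Set.finite_of_encard_le_coe (hG x)

/-- The finite set of neighbours of `x`; its cardinality is the degree of `x`. -/
noncomputable def DegreeLE.nbrs {V : Type*} {G : SimpleGraph V} {d : ℕ} (hG : DegreeLE G d)
    (x : V) : Finset V :=
  (hG.finite x).toFinset

theorem DegreeLE.mem_nbrs {V : Type*} {G : SimpleGraph V} {d : ℕ} (hG : DegreeLE G d) {x y : V} :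
    y ∈ hG.nbrs x ↔ G.Adj x y := by
  simp [DegreeLE.nbrs]

theorem DegreeLE.card_nbrs_le {V : Type*} {G : SimpleGraph V} {d : ℕ} (hG : DegreeLE G d) (x : V) :
    (hG.nbrs x).card ≤ d := by
  have h := hG x
  rw [(hG.finite x).encard_eq_coe_toFinset_card] at h
  exact_mod_cast h

/-- The closed ball of radius `r` around `x` in the path metric of `G`. Vertices in other
components are at distance `⊤`. -/
def closedBall {V : Type*} (G : SimpleGraph V) (x : V) (r : ℕ) : Set V :=
  {y | G.edist x y ≤ r}

theorem self_mem_closedBall {V : Type*} (G : SimpleGraph V) (x : V) (r : ℕ) :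
    x ∈ closedBall G x r := by
  simp [closedBall]

/-! ### Property A -/

/-- Property A: for every `ε > 0` there is a radius `r > 1` and a map from vertices to probability
measures, supported on `r`-balls, that varies by less than `ε` in `ℓ¹` along edges. -/
def PropertyA {V : Type*} (G : SimpleGraph V) : Prop :=
  ∀ ε : ℝ, 0 < ε → ∃ r : ℕ, 1 < r ∧ ∃ Θ : V → PMF V,
    (∀ x, (Θ x).support ⊆ closedBall G x r) ∧
    ∀ x y, G.Adj x y → ∑' z, |(Θ x z).toReal - (Θ y z).toReal| < ε

/-- The disjoint union of a family of graphs. -/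
def disjointUnion {ι : Type*} {V : ι → Type*} (G : ∀ i, SimpleGraph (V i)) :
    SimpleGraph (Σ i, V i) :=
  ⨆ i, (G i).map (Function.Embedding.sigmaMk i)

/-- A family of graphs possesses Property A if the disjoint union of its members does. -/
def FamilyPropertyA {ι : Type*} {V : ι → Type*} (G : ∀ i, SimpleGraph (V i)) : Prop :=
  PropertyA (disjointUnion G)

/-! ### Rooted balls and the neighborhood distance -/

/-- A rooted isomorphism between `(G, x)` and `(H, y)` exists. -/
def RootedIso {V W : Type*} (G : SimpleGraph V) (x : V) (H : SimpleGraph W) (y : W) : Prop :=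
  ∃ φ : G ≃g H, φ x = y

/-- A concrete model, on the vertex set `{0, …, size - 1}`, of a finite rooted `radius`-ball
of vertex degree bound `d`. -/
structure BallModel (d : ℕ) where
  radius : ℕ
  size : ℕ
  graph : SimpleGraph (Fin size)
  root : Fin size
  degree_le : DegreeLE graph d
  mem_ball : ∀ v, v ∈ closedBall graph root radius

/-- Two balls are identified if they have the same radius and are rooted-isomorphic. -/
instance BallModel.setoid (d : ℕ) : Setoid (BallModel d) where
  r B C := B.radius = C.radius ∧ RootedIso B.graph B.root C.graph C.root
  iseqv :=
    { refl := fun B => ⟨rfl, SimpleGraph.Iso.refl, rfl⟩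
      symm := by
        rintro B C ⟨h, φ, hφ⟩
        exact ⟨h.symm, φ.symm, by rw [← hφ]; exact φ.symm_apply_apply _⟩
      trans := by
        rintro B C D ⟨h, φ, hφ⟩ ⟨h', ψ, hψ⟩
        exact ⟨h.trans h', φ.trans ψ, by rw [← hψ, ← hφ]; rfl⟩ }

/-- The finite rooted balls, with their radii, of graphs of vertex degree bound `d`,
up to rooted isomorphism. -/
def RootedBall (d : ℕ) : Type := Quotient (BallModel.setoid d)

/-- The rooted ball represented by the model `B` occurs in `G`: it is rooted-isomorphic to the
subgraph of `G` induced on the ball of the same radius around some vertex. -/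
def BallModel.OccursIn {d : ℕ} (B : BallModel d) {V : Type*} (G : SimpleGraph V) : Prop :=
  ∃ x : V, RootedIso B.graph B.root
    (G.induce (closedBall G x B.radius)) ⟨x, self_mem_closedBall G x B.radius⟩

/-- The set `Ĝ` of all rooted balls of `G` up to rooted isomorphism. -/
def ballSet (d : ℕ) {V : Type*} (G : SimpleGraph V) : Set (RootedBall d) :=
  {b | ∃ B : BallModel d, (Quotient.mk _ B : RootedBall d) = b ∧ B.OccursIn G}

open Classical in
/-- The neighborhood distance for the enumeration `e 0, e 1, …` of the rooted balls: it is `2⁻ⁿ`,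
where the `n`-th ball, i.e. `e (n - 1)`, is the first one that belongs to exactly one of `Ĝ`, `Ĥ`;
it is `0` if `Ĝ = Ĥ`. -/
noncomputable def neighborhoodDist {d : ℕ} (e : ℕ ≃ RootedBall d) {V W : Type*}
    (G : SimpleGraph V) (H : SimpleGraph W) : ℝ :=
  if h : ∃ k, ¬ (e k ∈ ballSet d G ↔ e k ∈ ballSet d H) then (1 / 2 : ℝ) ^ (Nat.find h + 1) else 0

/-- Enumerations of the rooted balls exist. -/
theorem nonempty_enumeration (d : ℕ) : Nonempty (ℕ ≃ RootedBall d) := by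
  have h1 : Countable (BallModel d) := by
    let F : BallModel d → Σ _ : ℕ, Σ n : ℕ, SimpleGraph (Fin n) × Fin n :=
      fun B => ⟨B.radius, B.size, B.graph, B.root⟩
    have hF : Function.Injective F := by
      rintro ⟨r, n, g, x, _, _⟩ ⟨r', n', g', x', _, _⟩ h
      simp only [F, Sigma.mk.injEq, heq_eq_eq] at h
      obtain ⟨rfl, rfl, h⟩ := h
      simp only [heq_eq_eq, Prod.mk.injEq] at h
      obtain ⟨rfl, rfl⟩ := h
      rfl
    exact hF.countable
  have h2 : Countable (RootedBall d) := Quotient.countable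
  have h3 : Infinite (RootedBall d) := by
    let one : ℕ → BallModel d := fun r =>
      { radius := r, size := 1, graph := ⊥, root := 0
        degree_le := fun x => by simp [SimpleGraph.neighborSet]
        mem_ball := fun v => by
          rw [Subsingleton.elim v 0]
          exact self_mem_closedBall _ _ _ }
    refine Infinite.of_injective (fun r => (Quotient.mk _ (one r) : RootedBall d)) ?_
    intro r s h
    exact (Quotient.exact h).1
  exact ⟨(nonempty_denumerable (RootedBall d)).some.eqv.symm⟩

/-! ### The Laplacian -/

/-- The Laplacian on functions: `f ↦ (x ↦ deg(x) f(x) - ∑_{y ∼ x} f(y))`. -/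
noncomputable def lapFun {V : Type*} {G : SimpleGraph V} {d : ℕ} (hG : DegreeLE G d)
    (f : V → ℂ) (x : V) : ℂ :=
  (hG.nbrs x).card * f x - ∑ y ∈ hG.nbrs x, f y

theorem sum_nbrs_le {V : Type*} {G : SimpleGraph V} {d : ℕ} (hG : DegreeLE G d) {a : V → ℝ}
    (ha : ∀ x, 0 ≤ a x) (hs : Summable a) (s : Finset V) :
    ∑ x ∈ s, ∑ y ∈ hG.nbrs x, a y ≤ d * ∑' y, a y := by
  classical
  have h1 : ∑ x ∈ s, ∑ y ∈ hG.nbrs x, a y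
      = ∑ y ∈ s.biUnion hG.nbrs, ∑ x ∈ s.filter (fun x => x ∈ hG.nbrs y), a y := by
    refine Finset.sum_comm' ?_
    intro x y
    simp only [Finset.mem_filter, Finset.mem_biUnion, hG.mem_nbrs]
    constructor
    · rintro ⟨hx, h⟩
      exact ⟨⟨hx, h.symm⟩, x, hx, h⟩
    · rintro ⟨⟨hx, h⟩, _⟩
      exact ⟨hx, h.symm⟩
  rw [h1]
  calc _ ≤ ∑ y ∈ s.biUnion hG.nbrs, (d : ℝ) * a y := by
        refine Finset.sum_le_sum fun y _ => ?_
        rw [Finset.sum_const, nsmul_eq_mul]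
        refine mul_le_mul_of_nonneg_right ?_ (ha y)
        have h2 : (s.filter (fun x => x ∈ hG.nbrs y)).card ≤ (hG.nbrs y).card :=
          Finset.card_le_card fun x hx => (Finset.mem_filter.1 hx).2
        exact_mod_cast h2.trans (hG.card_nbrs_le y)
    _ = d * ∑ y ∈ s.biUnion hG.nbrs, a y := by rw [Finset.mul_sum]
    _ ≤ d * ∑' y, a y :=
        mul_le_mul_of_nonneg_left (hs.sum_le_tsum _ fun y _ => ha y) (Nat.cast_nonneg d)

theorem norm_lapFun_sq_le {V : Type*} {G : SimpleGraph V} {d : ℕ} (hG : DegreeLE G d)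
    (f : V → ℂ) (x : V) :
    ‖lapFun hG f x‖ ^ 2 ≤ 2 * d ^ 2 * ‖f x‖ ^ 2 + 2 * d * ∑ y ∈ hG.nbrs x, ‖f y‖ ^ 2 := by
  have hc : ((hG.nbrs x).card : ℝ) ≤ d := by exact_mod_cast hG.card_nbrs_le x
  have h1 : ‖lapFun hG f x‖ ≤ d * ‖f x‖ + ∑ y ∈ hG.nbrs x, ‖f y‖ := by
    refine (norm_sub_le _ _).trans (add_le_add ?_ (norm_sum_le _ _))
    rw [norm_mul, Complex.norm_natCast]
    exact mul_le_mul_of_nonneg_right hc (norm_nonneg _)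
  have h2 : (∑ y ∈ hG.nbrs x, ‖f y‖) ^ 2 ≤ d * ∑ y ∈ hG.nbrs x, ‖f y‖ ^ 2 :=
    sq_sum_le_card_mul_sum_sq.trans
      (mul_le_mul_of_nonneg_right hc (Finset.sum_nonneg fun _ _ => sq_nonneg _))
  have h3 : ‖lapFun hG f x‖ ^ 2 ≤ (d * ‖f x‖ + ∑ y ∈ hG.nbrs x, ‖f y‖) ^ 2 :=
    pow_le_pow_left₀ (norm_nonneg _) h1 2
  nlinarith [sq_nonneg (d * ‖f x‖ - ∑ y ∈ hG.nbrs x, ‖f y‖)]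

theorem sum_lapFun_sq_le {V : Type*} {G : SimpleGraph V} {d : ℕ} (hG : DegreeLE G d)
    (f : lp (fun _ : V => ℂ) 2) (s : Finset V) :
    ∑ x ∈ s, ‖lapFun hG f x‖ ^ (2 : ℝ≥0∞).toReal ≤ (2 * d * ‖f‖) ^ (2 : ℝ≥0∞).toReal := by
  have hsum := lp.hasSum_norm (p := 2) (by norm_num) f
  simp only [ENNReal.toReal_ofNat, Real.rpow_ofNat] at hsum ⊢
  have h1 := sum_nbrs_le hG (fun x => sq_nonneg ‖f x‖) hsum.summable s
  have h2 := hsum.summable.sum_le_tsum s (fun x _ => sq_nonneg ‖f x‖)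
  rw [hsum.tsum_eq] at h1 h2
  calc _ ≤ ∑ x ∈ s, (2 * d ^ 2 * ‖f x‖ ^ 2 + 2 * d * ∑ y ∈ hG.nbrs x, ‖f y‖ ^ 2) :=
        Finset.sum_le_sum fun x _ => norm_lapFun_sq_le hG f x
    _ = 2 * d ^ 2 * ∑ x ∈ s, ‖f x‖ ^ 2 + 2 * d * ∑ x ∈ s, ∑ y ∈ hG.nbrs x, ‖f y‖ ^ 2 := by
        rw [Finset.sum_add_distrib, Finset.mul_sum, Finset.mul_sum]
    _ ≤ 2 * d ^ 2 * ‖f‖ ^ 2 + 2 * d * (d * ‖f‖ ^ 2) := by gcongr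
    _ = _ := by ring

/-- The Laplacian `𝓛_G` as a bounded operator on the complex Hilbert space `ℓ²(V)`. -/
noncomputable def laplacian {V : Type*} {G : SimpleGraph V} {d : ℕ} (hG : DegreeLE G d) :
    lp (fun _ : V => ℂ) 2 →L[ℂ] lp (fun _ : V => ℂ) 2 :=
  LinearMap.mkContinuous
    { toFun := fun f => ⟨lapFun hG f, memℓp_gen' (sum_lapFun_sq_le hG f)⟩
      map_add' := fun f g => by
        ext x
        simp only [lapFun, lp.coeFn_add, Pi.add_apply, Finset.sum_add_distrib]
        ring
      map_smul' := fun c f => by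
        ext x
        simp only [lapFun, lp.coeFn_smul, Pi.smul_apply, smul_eq_mul, RingHom.id_apply,
          ← Finset.mul_sum]
        ring }
    (2 * d)
    (fun f => lp.norm_le_of_forall_sum_le (by norm_num) (by positivity) (sum_lapFun_sq_le hG f))

theorem laplacian_apply {V : Type*} {G : SimpleGraph V} {d : ℕ} (hG : DegreeLE G d)
    (f : lp (fun _ : V => ℂ) 2) (x : V) :
    laplacian hG f x = (hG.nbrs x).card * f x - ∑ y ∈ hG.nbrs x, f y :=
  rfl

/-- The spectrum of the Laplacian of `G`. -/
noncomputable def lapSpectrum {V : Type*} {G : SimpleGraph V} {d : ℕ} (hG : DegreeLE G d) :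
    Set ℂ :=
  spectrum ℂ (laplacian hG)

end BoundedDegree

/-! The Laplacian is self-adjoint, so approximate eigenvectors detect its spectrum: each spectral
`μ` has some `f` with `‖𝓛f - μf‖ < ε‖f‖`, and conversely such an `f` puts a spectral point within
`ε` of `μ`. If `f` lives on an `R`-ball, the inequality depends only on the `(R+1)`-ball, so `f` can
be transplanted to any graph in which that ball occurs
(`HasLocalEigenvector.exists_mem_lapSpectrum_of_occursIn`). Convergence in the neighborhood distance
makes the balls of any fixed radius eventually the same in `G n` and in `H`. What remains is to
localize.

Take cut-offs `φ z` with `∑ z, |φ z x|² = 1` at every vertex. The energies of the `φ z * f` add up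
to that of `f`, and their residual energies to at most twice that of `f` plus an error governed by
the variation of `φ` along edges, so some `φ z * f` is still an approximate eigenvector
(`exists_energy_residual_mul_lt`). Property A supplies `φ z x = √(Θ x z)`, with one radius for all
`n` and all `μ`; hence `Spec (G n)` is eventually close to `Spec H`. In the other direction no
uniformity is needed: truncation localizes each point of `Spec H` at its own radius
(`exists_hasLocalEigenvector`), and by compactness finitely many points suffice. -/

namespace BoundedDegree

/-! ### Approximate eigenvectors of normal operators -/

section NormalOperator

variable {E : Type*} [NormedAddCommGroup E] [InnerProductSpace ℂ E] [CompleteSpace E]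

/-- Otherwise `T - μ` is bounded below, hence injective with closed range. By normality the
orthogonal complement of the range is the kernel, which is zero, so `T - μ` is invertible. -/
theorem exists_approx_eigenvector_of_mem_spectrum {T : E →L[ℂ] E} (hT : IsStarNormal T) {μ : ℂ}
    (hμ : μ ∈ spectrum ℂ T) {ε : ℝ} (hε : 0 < ε) : ∃ f : E, ‖T f - μ • f‖ < ε * ‖f‖ := by
  by_contra! h
  refine hμ ?_
  have hN : IsStarNormal (T - algebraMap ℂ (E →L[ℂ] E) μ) := by
    constructor
    rw [star_sub, ← algebraMap_star_comm]
    exact (hT.star_comm_self.sub_left (Algebra.commute_algebraMap_left _ _)).sub_right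
      (Algebra.commute_algebraMap_right _ _)
  have hb : ∀ f : E, ‖f‖ ≤ (⟨ε⁻¹, by positivity⟩ : NNReal)
      * ‖(T - algebraMap ℂ (E →L[ℂ] E) μ) f‖ := fun f => by
    have h1 := h f
    change ‖f‖ ≤ ε⁻¹ * _
    rw [inv_mul_eq_div, le_div_iff₀ hε, mul_comm]
    simpa [Algebra.algebraMap_eq_smul_one] using h1
  have ha := ContinuousLinearMap.antilipschitz_of_bound _ hb
  rw [spectrum.mem_resolventSet_iff, ← neg_sub, IsUnit.neg_iff,
    ContinuousLinearMap.isUnit_iff_bijective,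
    ContinuousLinearMap.bijective_iff_dense_range_and_antilipschitz]
  refine ⟨?_, _, ha⟩
  rw [Submodule.topologicalClosure_eq_top_iff,
    ContinuousLinearMap.IsStarNormal.orthogonal_range hN, LinearMap.ker_eq_bot]
  exact ha.injective

/-- The resolvent at `μ` is normal, so its norm is attained by some `ρ` in its spectrum. Then `μ -
ρ⁻¹` is in the spectrum of `T`, and applying the resolvent to `T f - μ • f` shows `‖ρ‖⁻¹ < ε`. -/
theorem exists_mem_spectrum_of_approx_eigenvector {T : E →L[ℂ] E} (hT : IsStarNormal T) {μ : ℂ}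
    {ε : ℝ} (hε : 0 < ε) {f : E} (hf : ‖T f - μ • f‖ < ε * ‖f‖) :
    ∃ ν ∈ spectrum ℂ T, dist μ ν ≤ ε := by
  have hf0 : f ≠ 0 := by rintro rfl; simp at hf
  have : Nontrivial E := ⟨f, 0, hf0⟩
  by_cases hμ : μ ∈ spectrum ℂ T
  · exact ⟨μ, hμ, by simpa using hε.le⟩
  rw [spectrum.notMem_iff] at hμ
  obtain ⟨u, hu⟩ := hμ
  have hN : IsStarNormal ((↑u⁻¹ : E →L[ℂ] E)) := by
    have h1 : IsStarNormal (u : E →L[ℂ] E) := by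
      constructor
      rw [hu, star_sub, ← algebraMap_star_comm]
      exact ((Algebra.commute_algebraMap_left _ _).sub_left
        (Algebra.commute_algebraMap_right _ _)).sub_right
        ((Algebra.commute_algebraMap_left _ _).sub_left hT.star_comm_self)
    constructor
    have h2 : Commute (star u) u := Units.ext h1.star_comm_self
    have h3 := h2.inv_inv
    rw [← star_inv] at h3
    exact congrArg Units.val h3
  obtain ⟨ρ, hρ, hρ'⟩ := spectrum.exists_nnnorm_eq_spectralRadius (↑u⁻¹ : E →L[ℂ] E)
  rw [hN.spectralRadius_eq_nnnorm] at hρ'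
  have hρ'' : ‖ρ‖ = ‖(↑u⁻¹ : E →L[ℂ] E)‖ := congrArg NNReal.toReal (ENNReal.coe_inj.1 hρ')
  have hρ0 : ρ ≠ 0 := spectrum.ne_zero_of_mem_of_unit hρ
  have h4 : ρ⁻¹ ∈ spectrum ℂ (u : E →L[ℂ] E) := by
    rw [← inv_inv ρ] at hρ
    exact spectrum.inv₀_mem_inv_iff.1 hρ
  have h5 : μ - ρ⁻¹ ∈ spectrum ℂ T := by
    rw [hu] at h4
    rw [← spectrum.singleton_sub_eq] at h4
    obtain ⟨a, ha, b, hb, hab⟩ := h4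
    rw [Set.mem_singleton_iff] at ha
    subst ha
    simp only at hab
    rw [← hab]; simpa using hb
  refine ⟨_, h5, ?_⟩
  rw [dist_eq_norm, sub_sub_cancel, norm_inv]
  have h6 : f = (↑u⁻¹ : E →L[ℂ] E) ((u : E →L[ℂ] E) f) := by
    rw [← mul_apply_eq_comp, Units.inv_mul]; rfl
  have h7 : (u : E →L[ℂ] E) f = -(T f - μ • f) := by
    rw [hu]; simp [Algebra.algebraMap_eq_smul_one]
  have h8 : ‖f‖ ≤ ‖ρ‖ * ‖T f - μ • f‖ := by
    conv_lhs => rw [h6]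
    rw [hρ'', h7, ← norm_neg (T f - μ • f)]
    exact ContinuousLinearMap.le_opNorm _ _
  have h9 : 0 < ‖ρ‖ := norm_pos_iff.2 hρ0
  have h10 : 0 < ‖f‖ := norm_pos_iff.2 hf0
  rw [inv_le_iff_one_le_mul₀ h9]
  by_contra! h11
  have : ‖ρ‖ * ‖T f - μ • f‖ ≤ ‖ρ‖ * (ε * ‖f‖) := by gcongr
  nlinarith

end NormalOperator

/-! ### Self-adjointness of the Laplacian -/

theorem isSelfAdjoint_laplacian {V : Type*} {G : SimpleGraph V} {d : ℕ} (hG : DegreeLE G d) :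
    IsSelfAdjoint (laplacian hG) := by
  classical
  rw [ContinuousLinearMap.isSelfAdjoint_iff']
  -- Compare matrix entries in the standard basis; the matrix is real and symmetric because
  -- adjacency is.
  refine lp.ext_continuousLinearMap (by norm_num) fun x => ?_
  ext y
  have h : ∀ (f : lp (fun _ : V => ℂ) 2) (y : V), f y = inner ℂ (lp.single 2 y (1 : ℂ)) f := by
    intro f y
    simp [lp.inner_single_left]
  simp only [ContinuousLinearMap.comp_apply]
  rw [h _ y, ContinuousLinearMap.adjoint_inner_right]
  simp [lp.inner_single_right, laplacian_apply, lp.single_apply, Pi.single_apply, hG.mem_nbrs]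
  rw [G.adj_comm x y]
  by_cases hxy : x = y
  · subst hxy; simp
  · simp [hxy, Ne.symm hxy]

/-! ### Energy of functions on the vertices -/

/-- The square of the `ℓ²` norm, with value `∞` for functions outside `ℓ²`. -/
noncomputable def energy {V : Type*} (f : V → ℂ) : ℝ≥0∞ := ∑' x, ‖f x‖ₑ ^ 2

theorem energy_coe {V : Type*} (f : lp (fun _ : V => ℂ) 2) : energy f = ‖f‖ₑ ^ 2 := by
  have hsum := lp.hasSum_norm (p := 2) (by norm_num) f
  simp only [ENNReal.toReal_ofNat, Real.rpow_ofNat] at hsum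
  rw [← ofReal_norm, ← ENNReal.ofReal_pow (norm_nonneg _), ← hsum.tsum_eq,
    ENNReal.ofReal_tsum_of_nonneg (fun _ => by positivity) hsum.summable, energy]
  refine tsum_congr fun x => ?_
  rw [← ofReal_norm, ← ENNReal.ofReal_pow (norm_nonneg _)]

theorem memℓp_of_energy_ne_top {V : Type*} {f : V → ℂ} (hf : energy f ≠ ∞) : Memℓp f 2 := by
  refine memℓp_gen ?_
  have h := ENNReal.summable_toReal hf
  simpa using h

/-- The function `𝓛_G f - μ f`. -/
noncomputable def residual {V : Type*} {G : SimpleGraph V} {d : ℕ} (hG : DegreeLE G d) (μ : ℂ)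
    (f : V → ℂ) (x : V) : ℂ :=
  lapFun hG f x - μ * f x

theorem residual_coe {V : Type*} {G : SimpleGraph V} {d : ℕ} (hG : DegreeLE G d) (μ : ℂ)
    (f : lp (fun _ : V => ℂ) 2) : residual hG μ f = ⇑(laplacian hG f - μ • f) :=
  rfl

/-- Double counting: `a y` is counted once for each neighbour of `y`. -/
theorem tsum_sum_nbrs_le {V : Type*} {G : SimpleGraph V} {d : ℕ} (hG : DegreeLE G d)
    (a : V → ℝ≥0∞) : ∑' x, ∑ y ∈ hG.nbrs x, a y ≤ d * ∑' y, a y := by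
  classical
  have h : ∀ x, ∑ y ∈ hG.nbrs x, a y = ∑' y, if G.Adj x y then a y else 0 := fun x => by
    rw [tsum_eq_sum (s := hG.nbrs x) fun y hy => if_neg fun h => hy (hG.mem_nbrs.2 h)]
    exact Finset.sum_congr rfl fun y hy => (if_pos (hG.mem_nbrs.1 hy)).symm
  simp_rw [h]
  rw [ENNReal.tsum_comm, ← ENNReal.tsum_mul_left]
  refine ENNReal.tsum_le_tsum fun y => ?_
  rw [tsum_eq_sum (s := hG.nbrs y) fun x hx => if_neg fun h => hx (hG.mem_nbrs.2 h.symm)]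
  calc _ ≤ ∑ x ∈ hG.nbrs y, a y := Finset.sum_le_sum fun x _ => by split_ifs <;> simp
    _ = (hG.nbrs y).card * a y := by simp
    _ ≤ d * a y := by gcongr; exact hG.card_nbrs_le y

/-! ### Localization of approximate eigenvectors by cut-off functions -/

theorem enorm_add_sum_sq_le {ι : Type*} (a : ℂ) (s : Finset ι) (b : ι → ℂ) {d : ℕ}
    (hs : s.card ≤ d) :
    ‖a + ∑ i ∈ s, b i‖ₑ ^ 2 ≤ 2 * ‖a‖ₑ ^ 2 + 2 * d * ∑ i ∈ s, ‖b i‖ₑ ^ 2 := by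
  have h : ‖a + ∑ i ∈ s, b i‖₊ ^ 2 ≤ 2 * ‖a‖₊ ^ 2 + 2 * d * ∑ i ∈ s, ‖b i‖₊ ^ 2 :=
    calc ‖a + ∑ i ∈ s, b i‖₊ ^ 2 ≤ (‖a‖₊ + ∑ i ∈ s, ‖b i‖₊) ^ 2 := by
          gcongr
          exact (nnnorm_add_le _ _).trans (by gcongr; exact nnnorm_sum_le _ _)
      _ ≤ 2 * (‖a‖₊ ^ 2 + (∑ i ∈ s, ‖b i‖₊) ^ 2) := add_sq_le
      _ ≤ 2 * (‖a‖₊ ^ 2 + d * ∑ i ∈ s, ‖b i‖₊ ^ 2) := by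
          gcongr
          exact sq_sum_le_card_mul_sum_sq.trans (by gcongr)
      _ = _ := by ring
  simp only [enorm]
  exact_mod_cast h

/-- A Leibniz rule: the commutator of the Laplacian with multiplication by `φ` involves only
differences of `φ` along edges. -/
theorem residual_mul {V : Type*} {G : SimpleGraph V} {d : ℕ} (hG : DegreeLE G d) (μ : ℂ)
    (φ f : V → ℂ) (x : V) :
    residual hG μ (φ * f) x
      = φ x * residual hG μ f x + ∑ y ∈ hG.nbrs x, (φ x - φ y) * f y := by
  simp only [residual, lapFun, Pi.mul_apply, sub_mul, Finset.sum_sub_distrib, ← Finset.mul_sum]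
  ring

theorem tsum_energy_mul {V ι : Type*} {φ : ι → V → ℂ} (hφ : ∀ x, ∑' z, ‖φ z x‖ₑ ^ 2 = 1)
    (f : V → ℂ) : ∑' z, energy (φ z * f) = energy f := by
  simp only [energy, Pi.mul_apply, enorm_mul, mul_pow]
  rw [ENNReal.tsum_comm]
  simp [ENNReal.tsum_mul_right, hφ]

theorem tsum_energy_residual_mul_le {V ι : Type*} {G : SimpleGraph V} {d : ℕ} (hG : DegreeLE G d)
    (μ : ℂ) {φ : ι → V → ℂ} (hφ : ∀ x, ∑' z, ‖φ z x‖ₑ ^ 2 = 1) {δ : ℝ≥0∞}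
    (hδ : ∀ x y, G.Adj x y → ∑' z, ‖φ z x - φ z y‖ₑ ^ 2 ≤ δ) (f : V → ℂ) :
    ∑' z, energy (residual hG μ (φ z * f))
      ≤ 2 * energy (residual hG μ f) + 2 * d * (δ * (d * energy f)) := by
  calc ∑' z, energy (residual hG μ (φ z * f))
      ≤ ∑' z, ∑' x, (2 * ‖φ z x * residual hG μ f x‖ₑ ^ 2
          + 2 * d * ∑ y ∈ hG.nbrs x, ‖(φ z x - φ z y) * f y‖ₑ ^ 2) := by
        refine ENNReal.tsum_le_tsum fun z => ENNReal.tsum_le_tsum fun x => ?_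
        rw [residual_mul]
        exact enorm_add_sum_sq_le _ _ _ (hG.card_nbrs_le x)
    _ = ∑' x, (2 * ‖residual hG μ f x‖ₑ ^ 2
          + 2 * d * ∑ y ∈ hG.nbrs x, (∑' z, ‖φ z x - φ z y‖ₑ ^ 2) * ‖f y‖ₑ ^ 2) := by
        rw [ENNReal.tsum_comm]
        refine tsum_congr fun x => ?_
        simp only [enorm_mul, mul_pow]
        rw [ENNReal.tsum_add, ENNReal.tsum_mul_left, ENNReal.tsum_mul_right, hφ, one_mul,
          ENNReal.tsum_mul_left, Summable.tsum_finsetSum fun _ _ => ENNReal.summable]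
        simp_rw [ENNReal.tsum_mul_right]
    _ ≤ ∑' x, (2 * ‖residual hG μ f x‖ₑ ^ 2
          + 2 * d * (δ * ∑ y ∈ hG.nbrs x, ‖f y‖ₑ ^ 2)) := by
        refine ENNReal.tsum_le_tsum fun x => ?_
        rw [Finset.mul_sum (a := δ)]
        refine add_le_add le_rfl (mul_le_mul_right (Finset.sum_le_sum fun y hy => ?_) _)
        exact mul_le_mul_left (hδ x y (hG.mem_nbrs.1 hy)) _
    _ = 2 * energy (residual hG μ f)
          + 2 * d * (δ * ∑' x, ∑ y ∈ hG.nbrs x, ‖f y‖ₑ ^ 2) := by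
        rw [ENNReal.tsum_add, ENNReal.tsum_mul_left, ENNReal.tsum_mul_left, ENNReal.tsum_mul_left,
          energy]
    _ ≤ _ := by
        gcongr
        exact tsum_sum_nbrs_le hG _

/-- If `f` is an approximate eigenvector, then so is one of the functions `φ z * f`. -/
theorem exists_energy_residual_mul_lt {V ι : Type*} {G : SimpleGraph V} {d : ℕ}
    (hG : DegreeLE G d) (μ : ℂ) {φ : ι → V → ℂ} (hφ : ∀ x, ∑' z, ‖φ z x‖ₑ ^ 2 = 1) {δ : ℝ≥0∞}
    (hδ : ∀ x y, G.Adj x y → ∑' z, ‖φ z x - φ z y‖ₑ ^ 2 ≤ δ) (hδ' : δ ≠ ∞) {f : V → ℂ}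
    (hf : energy f ≠ ∞) {η : ℝ≥0∞} (hη : energy (residual hG μ f) < η * energy f) :
    ∃ z, energy (residual hG μ (φ z * f)) < (2 * η + 2 * d ^ 2 * δ) * energy (φ z * f) := by
  by_contra! h
  have h1 := (ENNReal.tsum_le_tsum h).trans (tsum_energy_residual_mul_le hG μ hφ hδ f)
  rw [ENNReal.tsum_mul_left, tsum_energy_mul hφ] at h1
  refine absurd h1 (not_le.2 ?_)
  -- Adding an infinite term would destroy the strict inequality.
  have hfin : 2 * d * (δ * (d * energy f)) ≠ ∞ := by finiteness
  have h2 : (2 * η + 2 * d ^ 2 * δ) * energy f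
      = 2 * (η * energy f) + 2 * d * (δ * (d * energy f)) := by ring
  rw [h2]
  exact ENNReal.add_lt_add_right hfin (by gcongr; norm_num)

/-! ### Balls -/

theorem mem_closedBall_iff_exists_walk {V : Type*} {G : SimpleGraph V} {x y : V} {r : ℕ} :
    y ∈ closedBall G x r ↔ ∃ p : G.Walk x y, p.length ≤ r := by
  constructor
  · intro h
    have h' : G.edist x y ≤ r := h
    obtain ⟨p, hp⟩ := G.exists_walk_of_edist_ne_top (ne_top_of_le_ne_top (by simp) h')
    exact ⟨p, by rw [← hp] at h'; exact_mod_cast h'⟩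
  · rintro ⟨p, hp⟩
    exact (G.edist_le p).trans (by exact_mod_cast hp)

theorem closedBall_mono {V : Type*} (G : SimpleGraph V) (x : V) {r s : ℕ} (h : r ≤ s) :
    closedBall G x r ⊆ closedBall G x s := fun _ hy =>
  le_trans (show G.edist x _ ≤ r from hy) (by exact_mod_cast h)

theorem mem_closedBall_comm {V : Type*} {G : SimpleGraph V} {x y : V} {r : ℕ} :
    y ∈ closedBall G x r ↔ x ∈ closedBall G y r := by
  simp [closedBall, SimpleGraph.edist_comm]

theorem mem_closedBall_trans {V : Type*} {G : SimpleGraph V} {x y z : V} {r s : ℕ}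
    (hy : y ∈ closedBall G x r) (hz : z ∈ closedBall G y s) : z ∈ closedBall G x (r + s) := by
  rw [mem_closedBall_iff_exists_walk] at *
  obtain ⟨p, hp⟩ := hy
  obtain ⟨q, hq⟩ := hz
  exact ⟨p.append q, by rw [SimpleGraph.Walk.length_append]; omega⟩

theorem mem_closedBall_one_of_adj {V : Type*} {G : SimpleGraph V} {x y : V} (h : G.Adj x y) :
    y ∈ closedBall G x 1 :=
  mem_closedBall_iff_exists_walk.2 ⟨h.toWalk, by simp⟩

theorem mem_closedBall_map {V W : Type*} {G : SimpleGraph V} {H : SimpleGraph W} (φ : G →g H)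
    {x y : V} {r : ℕ} (hy : y ∈ closedBall G x r) : φ y ∈ closedBall H (φ x) r := by
  rw [mem_closedBall_iff_exists_walk] at *
  obtain ⟨p, hp⟩ := hy
  exact ⟨p.map φ, by rwa [SimpleGraph.Walk.length_map]⟩

theorem closedBall_succ_of_mem {V : Type*} {G : SimpleGraph V} {x y : V} {r : ℕ}
    (hy : y ∈ closedBall G x r) :
    y ∈ closedBall G x (r + 1) ∧ ∀ z, G.Adj y z → z ∈ closedBall G x (r + 1) :=
  ⟨closedBall_mono G x (Nat.le_succ r) hy, fun _ hz =>
    mem_closedBall_trans hy (mem_closedBall_one_of_adj hz)⟩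

/-- The induced subgraph on a ball has the same smaller balls around the centre. -/
theorem mem_closedBall_induce {V : Type*} {G : SimpleGraph V} {x : V} {r s : ℕ} (hrs : r ≤ s)
    {y : closedBall G x s} (hy : (y : V) ∈ closedBall G x r) :
    y ∈ closedBall (G.induce (closedBall G x s)) ⟨x, self_mem_closedBall G x s⟩ r := by
  classical
  obtain ⟨y, hys⟩ := y
  rw [mem_closedBall_iff_exists_walk] at hy ⊢
  obtain ⟨p, hp⟩ := hy
  have h : ∀ z ∈ p.support, z ∈ closedBall G x s := fun z hz =>
    mem_closedBall_iff_exists_walk.2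
      ⟨p.takeUntil z hz, (p.length_takeUntil_le_length hz).trans (hp.trans hrs)⟩
  refine ⟨p.induce _ h, ?_⟩
  have h2 := congrArg SimpleGraph.Walk.length (p.map_induce h)
  rw [SimpleGraph.Walk.length_map] at h2
  exact h2.le.trans hp

theorem DegreeLE.encard_closedBall_le {V : Type*} {G : SimpleGraph V} {d : ℕ} (hG : DegreeLE G d)
    (x : V) (r : ℕ) : (closedBall G x r).encard ≤ ((d + 1) ^ r : ℕ) := by
  classical
  suffices h : ∃ s : Finset V, closedBall G x r ⊆ s ∧ s.card ≤ (d + 1) ^ r by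
    obtain ⟨s, hs, hc⟩ := h
    refine (Set.encard_le_encard hs).trans ?_
    rw [Set.encard_coe_eq_coe_finsetCard]
    exact_mod_cast hc
  induction r with
  | zero =>
    refine ⟨{x}, fun y hy => ?_, by simp⟩
    simpa using (show y = x by simpa [closedBall] using hy)
  | succ r ih =>
    obtain ⟨s, hs, hc⟩ := ih
    -- The penultimate vertex of a walk of length `r + 1` is in the `r`-ball, so closed
    -- neighbourhoods of that ball cover the next one.
    refine ⟨s.biUnion fun y => insert y (hG.nbrs y), fun y hy => ?_, ?_⟩
    · rw [mem_closedBall_iff_exists_walk] at hy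
      obtain ⟨p, hp⟩ := hy
      simp only [Finset.coe_biUnion, Set.mem_iUnion, Finset.mem_coe, Finset.mem_insert,
        hG.mem_nbrs]
      rcases Nat.lt_or_ge r p.length with h | h
      · have hnil : ¬ p.Nil := by
          intro hn
          rw [← SimpleGraph.Walk.length_eq_zero_iff] at hn
          omega
        refine ⟨p.penultimate, hs (mem_closedBall_iff_exists_walk.2 ⟨p.dropLast, ?_⟩),
          Or.inr (p.adj_penultimate hnil)⟩
        simp
        omega
      · exact ⟨y, hs (mem_closedBall_iff_exists_walk.2 ⟨p, h⟩), Or.inl rfl⟩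
    · refine Finset.card_biUnion_le.trans ?_
      refine (Finset.sum_le_card_nsmul _ _ (d + 1) fun y _ => ?_).trans ?_
      · exact (Finset.card_insert_le _ _).trans (Nat.succ_le_succ (hG.card_nbrs_le y))
      · rw [smul_eq_mul, pow_succ]
        gcongr

theorem DegreeLE.finite_closedBall {V : Type*} {G : SimpleGraph V} {d : ℕ} (hG : DegreeLE G d)
    (x : V) (r : ℕ) : (closedBall G x r).Finite :=
  Set.finite_of_encard_le_coe (hG.encard_closedBall_le x r)

/-! ### Models of balls -/

theorem DegreeLE.of_embedding {V W : Type*} {G : SimpleGraph V} {H : SimpleGraph W} {d : ℕ}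
    (hH : DegreeLE H d) (φ : G ↪g H) : DegreeLE G d := fun x => by
  rw [← φ.injective.encard_image]
  refine (Set.encard_le_encard ?_).trans (hH (φ x))
  rintro _ ⟨y, hy, rfl⟩
  exact φ.map_adj_iff.2 hy

/-- Every ball has a model. -/
theorem exists_ballModel {V : Type*} {G : SimpleGraph V} {d : ℕ} (hG : DegreeLE G d) (x : V)
    (r : ℕ) : ∃ B : BallModel d, B.radius = r ∧ RootedIso B.graph B.root
      (G.induce (closedBall G x r)) ⟨x, self_mem_closedBall G x r⟩ := by
  have := (hG.finite_closedBall x r).to_subtype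
  let ε := Finite.equivFin (closedBall G x r)
  let ψ := SimpleGraph.Iso.comap ε.symm (G.induce (closedBall G x r))
  refine ⟨⟨r, _, _, ε ⟨x, self_mem_closedBall G x r⟩,
    hG.of_embedding (ψ.toEmbedding.trans (SimpleGraph.Embedding.induce _)), fun v => ?_⟩,
    rfl, ψ, ε.symm_apply_apply _⟩
  have h := mem_closedBall_map ψ.symm.toHom (mem_closedBall_induce le_rfl (ε.symm v).2)
  have h2 : ψ.symm.toHom (ε.symm v) = v := ε.apply_symm_apply v
  rw [h2] at h
  exact h

theorem BallModel.occursIn_iff {d : ℕ} {B : BallModel d} {r : ℕ} (hB : B.radius = r) {V : Type*}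
    {G : SimpleGraph V} : B.OccursIn G ↔ ∃ x : V, RootedIso B.graph B.root
      (G.induce (closedBall G x r)) ⟨x, self_mem_closedBall G x r⟩ := by
  subst hB
  rfl

theorem BallModel.OccursIn.congr {d : ℕ} {B C : BallModel d} (h : B ≈ C) {V : Type*}
    {G : SimpleGraph V} (hB : B.OccursIn G) : C.OccursIn G := by
  obtain ⟨r, n, g, a, _, _⟩ := B
  obtain ⟨r', n', g', a', _, _⟩ := C
  obtain ⟨hr, φ, hφ⟩ := h
  obtain ⟨x, ψ, hψ⟩ := hB
  dsimp only at hr φ hφ ψ hψ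
  subst hr
  refine ⟨x, φ.symm.trans ψ, ?_⟩
  exact (congrArg ψ ((congrArg φ.symm hφ.symm).trans (φ.symm_apply_apply a))).trans hψ

theorem mk_mem_ballSet_iff {d : ℕ} {B : BallModel d} {V : Type*} {G : SimpleGraph V} :
    (Quotient.mk _ B : RootedBall d) ∈ ballSet d G ↔ B.OccursIn G := by
  constructor
  · rintro ⟨C, hC, h⟩
    exact h.congr (Quotient.exact hC)
  · exact fun h => ⟨B, rfl, h⟩

/-- A model is its own ball, so its size is at most `(d + 1) ^ r`. Finiteness turns convergence ball
by ball into agreement on all balls of radius `r` at once. -/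
theorem finite_setOf_radius_eq (d r : ℕ) : {B : BallModel d | B.radius = r}.Finite := by
  let F : {B : BallModel d | B.radius = r} →
      Σ n : Fin ((d + 1) ^ r + 1), SimpleGraph (Fin n) × Fin n := fun B =>
    ⟨⟨B.1.size, by
      have h := B.1.degree_le.encard_closedBall_le B.1.root B.1.radius
      rw [Set.eq_univ_of_forall B.1.mem_ball, B.2, Set.encard_univ, ENat.card_eq_coe_fintype_card,
        Fintype.card_fin] at h
      exact Nat.lt_succ_of_le (by exact_mod_cast h)⟩, B.1.graph, B.1.root⟩
  have hF : Function.Injective F := by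
    rintro ⟨⟨s, n, g, x, _, _⟩, h₁⟩ ⟨⟨s', n', g', x', _, _⟩, h₂⟩ h
    change s = r at h₁
    change s' = r at h₂
    subst h₁ h₂
    simp only [F, Sigma.mk.injEq, Fin.mk.injEq] at h
    obtain ⟨rfl, h⟩ := h
    simp only [heq_eq_eq, Prod.mk.injEq] at h
    obtain ⟨rfl, rfl⟩ := h
    rfl
  exact Finite.of_injective F hF

/-! ### Convergence in the neighborhood distance -/

theorem eventually_mem_ballSet_iff {d : ℕ} {e : ℕ ≃ RootedBall d} {V : ℕ → Type*}
    {G : ∀ n, SimpleGraph (V n)} {W : Type*} {H : SimpleGraph W}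
    (hlim : Tendsto (fun n => neighborhoodDist e (G n) H) atTop (𝓝 0)) (b : RootedBall d) :
    ∀ᶠ n in atTop, (b ∈ ballSet d (G n) ↔ b ∈ ballSet d H) := by
  classical
  obtain ⟨k, rfl⟩ := e.surjective b
  -- A disagreement at index `k` would force the distance to be at least `(1 / 2) ^ (k + 1)`.
  filter_upwards [hlim.eventually_lt_const (show (0 : ℝ) < (1 / 2) ^ (k + 1) by positivity)]
    with n hn
  by_contra hk
  have hex : ∃ k, ¬ (e k ∈ ballSet d (G n) ↔ e k ∈ ballSet d H) := ⟨k, hk⟩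
  rw [neighborhoodDist, dif_pos hex] at hn
  refine absurd hn (not_lt.2 (pow_le_pow_of_le_one (by norm_num) (by norm_num) ?_))
  exact Nat.succ_le_succ (Nat.find_min' hex hk)

theorem eventually_occursIn_iff {d : ℕ} {e : ℕ ≃ RootedBall d} {V : ℕ → Type*}
    {G : ∀ n, SimpleGraph (V n)} {W : Type*} {H : SimpleGraph W}
    (hlim : Tendsto (fun n => neighborhoodDist e (G n) H) atTop (𝓝 0)) (r : ℕ) :
    ∀ᶠ n in atTop, ∀ B : BallModel d, B.radius = r → (B.OccursIn (G n) ↔ B.OccursIn H) := by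
  refine ((finite_setOf_radius_eq d r).eventually_all).2 fun B _ => ?_
  exact (eventually_mem_ballSet_iff hlim (Quotient.mk _ B)).mono fun n hn =>
    mk_mem_ballSet_iff.symm.trans (hn.trans mk_mem_ballSet_iff)

/-! ### Localized approximate eigenvectors -/

/-- There is an approximate eigenvector supported on the `R`-ball around `x`. -/
def HasLocalEigenvector {V : Type*} {G : SimpleGraph V} {d : ℕ} (hG : DegreeLE G d) (μ : ℂ)
    (η : ℝ≥0∞) (R : ℕ) (x : V) : Prop :=
  ∃ f : V → ℂ, (∀ y, f y ≠ 0 → y ∈ closedBall G x R) ∧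
    energy (residual hG μ f) < η * energy f

theorem energy_residual_lt_iff {V : Type*} {G : SimpleGraph V} {d : ℕ} (hG : DegreeLE G d)
    (μ : ℂ) {ε : ℝ} (hε : 0 ≤ ε) (f : lp (fun _ : V => ℂ) 2) :
    energy (residual hG μ f) < ENNReal.ofReal (ε ^ 2) * energy f ↔
      ‖laplacian hG f - μ • f‖ < ε * ‖f‖ := by
  rw [residual_coe, energy_coe, energy_coe, ← ofReal_norm, ← ofReal_norm,
    ENNReal.ofReal_pow hε, ← mul_pow, ← ENNReal.ofReal_mul hε,
    ENNReal.pow_lt_pow_left_iff two_ne_zero, ENNReal.ofReal_lt_ofReal_iff_of_nonneg (norm_nonneg _)]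

theorem energy_ne_top {V : Type*} (f : lp (fun _ : V => ℂ) 2) : energy f ≠ ∞ := by
  rw [energy_coe]
  finiteness

theorem isStarNormal_laplacian {V : Type*} {G : SimpleGraph V} {d : ℕ} (hG : DegreeLE G d) :
    IsStarNormal (laplacian hG) :=
  (isSelfAdjoint_laplacian hG).isStarNormal

theorem HasLocalEigenvector.exists_mem_lapSpectrum {V : Type*} {G : SimpleGraph V} {d : ℕ}
    {hG : DegreeLE G d} {μ : ℂ} {ε : ℝ} (hε : 0 < ε) {R : ℕ} {x : V}
    (h : HasLocalEigenvector hG μ (ENNReal.ofReal (ε ^ 2)) R x) :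
    ∃ ν ∈ lapSpectrum hG, dist μ ν ≤ ε := by
  obtain ⟨f, hf, hlt⟩ := h
  have hfin : energy f ≠ ∞ := by
    rw [energy, tsum_eq_sum (s := (hG.finite_closedBall x R).toFinset) fun y hy => by
      have : f y = 0 := by
        by_contra h0
        exact hy (by simpa using hf y h0)
      simp [this]]
    exact ENNReal.sum_ne_top.2 fun y _ => by finiteness
  let g : lp (fun _ : V => ℂ) 2 := ⟨f, memℓp_of_energy_ne_top hfin⟩
  exact exists_mem_spectrum_of_approx_eigenvector (isStarNormal_laplacian hG) hε
    ((energy_residual_lt_iff hG μ hε.le g).1 hlt)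

/-- Approximate eigenvectors can be chosen with finite support. -/
theorem exists_finite_support_of_mem_lapSpectrum {V : Type*} {G : SimpleGraph V} {d : ℕ}
    {hG : DegreeLE G d} {μ : ℂ} (hμ : μ ∈ lapSpectrum hG) {ε : ℝ} (hε : 0 < ε) :
    ∃ f : lp (fun _ : V => ℂ) 2, (Function.support f).Finite ∧
      ‖laplacian hG f - μ • f‖ < ε * ‖f‖ := by
  classical
  obtain ⟨f, hf⟩ := exists_approx_eigenvector_of_mem_spectrum (isStarNormal_laplacian hG) hμ hε
  -- The strict inequality is an open condition, so it passes from `f` to a finite partial sum of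
  -- its basis expansion.
  have ho : IsOpen {f : lp (fun _ : V => ℂ) 2 | ‖laplacian hG f - μ • f‖ < ε * ‖f‖} :=
    isOpen_lt (by fun_prop) (by fun_prop)
  obtain ⟨s, hs⟩ := ((lp.hasSum_single (by norm_num) f).eventually (ho.mem_nhds hf)).exists
  refine ⟨_, s.finite_toSet.subset fun x hx => ?_, hs⟩
  by_contra hxs
  refine hx ?_
  rw [lp.coeFn_sum, Finset.sum_apply]
  refine Finset.sum_eq_zero fun y hy => ?_
  have hxy : x ≠ y := by rintro rfl; exact hxs hy
  simp [lp.single_apply, hxy]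

/-- An approximate eigenvector with finite support can be cut down to one component. -/
theorem exists_hasLocalEigenvector {V : Type*} {G : SimpleGraph V} {d : ℕ}
    {hG : DegreeLE G d} {μ : ℂ} (hμ : μ ∈ lapSpectrum hG) {ε : ℝ} (hε : 0 < ε) :
    ∃ R x, HasLocalEigenvector hG μ (ENNReal.ofReal (ε ^ 2)) R x := by
  classical
  obtain ⟨f, hfin, hf⟩ := exists_finite_support_of_mem_lapSpectrum hμ (half_pos hε)
  rw [← energy_residual_lt_iff hG μ (half_pos hε).le] at hf
  -- Indicators of components do not vary along edges, so here `δ = 0`; the only loss is the factor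
  -- 2, absorbed by having started from `ε / 2`.
  let φ : G.ConnectedComponent → V → ℂ := fun C x => if G.connectedComponentMk x = C then 1 else 0
  have hφ : ∀ x, ∑' C, ‖φ C x‖ₑ ^ 2 = 1 := fun x => by
    rw [tsum_eq_single (G.connectedComponentMk x) fun C hC => by simp [φ, hC.symm]]
    simp [φ]
  obtain ⟨C, hC⟩ := exists_energy_residual_mul_lt hG μ hφ (δ := 0) (fun x y hxy => by
    simp [φ, SimpleGraph.ConnectedComponent.connectedComponentMk_eq_of_adj hxy]) (by simp)
    (energy_ne_top f) hf
  have hne : φ C * ⇑f ≠ 0 := by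
    intro h0
    rw [h0] at hC
    simp [energy] at hC
  obtain ⟨x, hx⟩ := Function.ne_iff.1 hne
  have hmem : ∀ y, (φ C * ⇑f) y ≠ 0 → G.connectedComponentMk y = C ∧ y ∈ Function.support f := by
    intro y hy
    simp only [Pi.mul_apply, φ] at hy
    split_ifs at hy with h
    · exact ⟨h, by simpa using hy⟩
    · simp at hy
  have hball : ∀ y, ∃ r, (φ C * ⇑f) y ≠ 0 → y ∈ closedBall G x r := by
    intro y
    by_cases hy : (φ C * ⇑f) y = 0
    · exact ⟨0, fun h => absurd hy h⟩
    · obtain ⟨p⟩ : G.Reachable x y :=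
        SimpleGraph.ConnectedComponent.eq.1 ((hmem x hx).1.trans (hmem y hy).1.symm)
      exact ⟨p.length, fun _ => mem_closedBall_iff_exists_walk.2 ⟨p, le_rfl⟩⟩
  choose r hr using hball
  refine ⟨hfin.toFinset.sup r, x, _, fun y hy => closedBall_mono G x ?_ (hr y hy),
    hC.trans_le ?_⟩
  · exact Finset.le_sup (by simpa using (hmem y hy).2)
  · gcongr
    rw [mul_zero, add_zero, ← ENNReal.ofReal_ofNat 2, ← ENNReal.ofReal_mul (by norm_num)]
    exact ENNReal.ofReal_le_ofReal (by nlinarith)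

/-! ### Localization by Property A -/

/-- Uses `|√a - √b| ≤ √a + √b`. It turns `ℓ¹` variation of measures into `ℓ²` variation of their
square roots. -/
theorem sq_sqrt_sub_sqrt_le {a b : ℝ} (ha : 0 ≤ a) (hb : 0 ≤ b) : (√a - √b) ^ 2 ≤ |a - b| := by
  have h : a - b = (√a - √b) * (√a + √b) := by
    nlinarith [Real.sq_sqrt ha, Real.sq_sqrt hb]
  rw [h, abs_mul, ← sq_abs, sq, abs_of_nonneg (show 0 ≤ √a + √b by positivity)]
  gcongr
  rw [abs_le]
  constructor <;> linarith [Real.sqrt_nonneg a, Real.sqrt_nonneg b]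

/-- The measures live on a separate type `P` because Property A of a family gives, at the vertices
of one graph, measures on the whole disjoint union. -/
theorem exists_energy_residual_sqrt_mul_lt {V P : Type*} {G : SimpleGraph V} {d : ℕ}
    (hG : DegreeLE G d) (μ : ℂ) (Θ : V → PMF P) {δ : ℝ}
    (hΘ : ∀ x y, G.Adj x y → ∑' z, |(Θ x z).toReal - (Θ y z).toReal| < δ) {f : V → ℂ}
    (hf : energy f ≠ ∞) {η : ℝ≥0∞} (hη : energy (residual hG μ f) < η * energy f) :
    ∃ g : V → ℂ, (∃ z, ∀ x, g x ≠ 0 → z ∈ (Θ x).support) ∧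
      energy (residual hG μ g) < (2 * η + 2 * d ^ 2 * ENNReal.ofReal δ) * energy g := by
  let φ : P → V → ℂ := fun z x => ((√(Θ x z).toReal : ℝ) : ℂ)
  have hφ : ∀ x, ∑' z, ‖φ z x‖ₑ ^ 2 = 1 := fun x => by
    rw [← (Θ x).tsum_coe]
    refine tsum_congr fun z => ?_
    rw [← ofReal_norm, ← ENNReal.ofReal_pow (norm_nonneg _), Complex.norm_real, Real.norm_eq_abs,
      sq_abs, Real.sq_sqrt ENNReal.toReal_nonneg, ENNReal.ofReal_toReal ((Θ x).apply_ne_top z)]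
  have hs : ∀ x, Summable fun z => (Θ x z).toReal := fun x =>
    ENNReal.summable_toReal (Θ x).tsum_coe_ne_top
  have hδ : ∀ x y, G.Adj x y → ∑' z, ‖φ z x - φ z y‖ₑ ^ 2 ≤ ENNReal.ofReal δ := by
    intro x y hxy
    refine le_trans ?_ (ENNReal.ofReal_le_ofReal (hΘ x y hxy).le)
    rw [ENNReal.ofReal_tsum_of_nonneg (fun _ => abs_nonneg _) ((hs x).sub (hs y)).abs]
    refine ENNReal.tsum_le_tsum fun z => ?_
    rw [← ofReal_norm, ← ENNReal.ofReal_pow (norm_nonneg _), ← Complex.ofReal_sub,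
      Complex.norm_real, Real.norm_eq_abs, sq_abs]
    exact ENNReal.ofReal_le_ofReal
      (sq_sqrt_sub_sqrt_le ENNReal.toReal_nonneg ENNReal.toReal_nonneg)
  obtain ⟨z, hz⟩ := exists_energy_residual_mul_lt hG μ hφ hδ (by simp) hf hη
  refine ⟨_, ⟨z, fun x hx h0 => hx ?_⟩, hz⟩
  simp [φ, h0]

theorem disjointUnion_adj {ι : Type*} {V : ι → Type*} {G : ∀ i, SimpleGraph (V i)} {i : ι}
    {x : V i} {w : Σ i, V i} :
    (disjointUnion G).Adj ⟨i, x⟩ w ↔ ∃ y, w = ⟨i, y⟩ ∧ (G i).Adj x y := by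
  simp only [disjointUnion, SimpleGraph.iSup_adj, SimpleGraph.map_adj]
  constructor
  · rintro ⟨j, a, b, hab, ha, rfl⟩
    simp only [Function.Embedding.sigmaMk_apply, Sigma.mk.injEq] at ha
    obtain ⟨rfl, ha⟩ := ha
    rw [heq_eq_eq] at ha
    subst ha
    exact ⟨b, rfl, hab⟩
  · rintro ⟨y, rfl, h⟩
    exact ⟨i, x, y, h, rfl, rfl⟩

theorem exists_walk_of_walk_disjointUnion {ι : Type*} {V : ι → Type*} {G : ∀ i, SimpleGraph (V i)}
    {v w : Σ i, V i} (p : (disjointUnion G).Walk v w) :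
    ∃ (y : V v.1) (q : (G v.1).Walk v.2 y), w = ⟨v.1, y⟩ ∧ q.length = p.length := by
  induction p with
  | nil => exact ⟨_, .nil, rfl, rfl⟩
  | @cons u v w h p ih =>
    obtain ⟨i, x⟩ := u
    obtain ⟨y, rfl, hxy⟩ := disjointUnion_adj.1 h
    obtain ⟨z, q, rfl, hq⟩ := ih
    exact ⟨z, .cons hxy q, rfl, by simp [hq]⟩

theorem mem_closedBall_of_disjointUnion {ι : Type*} {V : ι → Type*} {G : ∀ i, SimpleGraph (V i)}
    {i : ι} {x y : V i} {r : ℕ} (h : ⟨i, y⟩ ∈ closedBall (disjointUnion G) ⟨i, x⟩ r) :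
    y ∈ closedBall (G i) x r := by
  obtain ⟨p, hp⟩ := mem_closedBall_iff_exists_walk.1 h
  obtain ⟨z, q, hz, hq⟩ := exists_walk_of_walk_disjointUnion p
  obtain rfl : y = z := by simpa using hz
  exact mem_closedBall_iff_exists_walk.2 ⟨q, hq.trans_le hp⟩

/-- In a family of Property A, the approximate eigenvectors can be localized uniformly. -/
theorem FamilyPropertyA.exists_hasLocalEigenvector {ι : Type*} {V : ι → Type*}
    {G : ∀ i, SimpleGraph (V i)} (hA : FamilyPropertyA G) {d : ℕ} (hG : ∀ i, DegreeLE (G i) d)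
    {ε : ℝ} (hε : 0 < ε) :
    ∃ R, ∀ i, ∀ μ ∈ lapSpectrum (hG i),
      ∃ x, HasLocalEigenvector (hG i) μ (ENNReal.ofReal (ε ^ 2)) R x := by
  -- With this bound as `δ`, `2 * (ε / 2) ^ 2 + 2 * d ^ 2 * δ ≤ ε ^ 2`; the `+ 1` covers `d = 0`.
  obtain ⟨r, -, Θ, hsupp, hΘ⟩ := hA (ε ^ 2 / (4 * (d ^ 2 + 1))) (by positivity)
  -- All support points lie within `r` of a common `z`, hence within `2r` of each other.
  refine ⟨r + r, fun i μ hμ => ?_⟩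
  obtain ⟨f, hf⟩ := exists_approx_eigenvector_of_mem_spectrum (isStarNormal_laplacian (hG i)) hμ
    (half_pos hε)
  rw [← energy_residual_lt_iff (hG i) μ (half_pos hε).le] at hf
  obtain ⟨g, ⟨z, hz⟩, hg⟩ := exists_energy_residual_sqrt_mul_lt (hG i) μ (fun x => Θ ⟨i, x⟩)
    (fun x y hxy => hΘ _ _ (disjointUnion_adj.2 ⟨y, rfl, hxy⟩)) (energy_ne_top f) hf
  have hne : g ≠ 0 := by
    rintro rfl
    simp [energy] at hg
  obtain ⟨x, hx⟩ := Function.ne_iff.1 hne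
  refine ⟨x, g, fun y hy => mem_closedBall_of_disjointUnion (mem_closedBall_trans
    (hsupp _ (hz x hx)) (mem_closedBall_comm.1 (hsupp _ (hz y hy)))), hg.trans_le ?_⟩
  gcongr
  rw [← ENNReal.ofReal_ofNat 2, ← ENNReal.ofReal_natCast, ← ENNReal.ofReal_pow (by positivity),
    ← ENNReal.ofReal_mul (by norm_num), ← ENNReal.ofReal_mul (by norm_num),
    ← ENNReal.ofReal_mul (by positivity), ← ENNReal.ofReal_add (by positivity) (by positivity)]
  refine ENNReal.ofReal_le_ofReal ?_
  have h1 : 2 * (d : ℝ) ^ 2 * (ε ^ 2 / (4 * (d ^ 2 + 1))) ≤ ε ^ 2 / 2 := by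
    rw [mul_div_assoc', div_le_div_iff₀ (by positivity) (by positivity)]
    nlinarith [sq_nonneg ε]
  nlinarith

/-! ### Transfer of localized functions along isomorphisms of balls -/

theorem tsum_eq_tsum_of_equiv {V W M : Type*} [AddCommMonoid M] [TopologicalSpace M]
    {s : Set V} {t : Set W} (ψ : s ≃ t) {F : V → M} {F' : W → M}
    (hF : Function.support F ⊆ s) (hF' : Function.support F' ⊆ t)
    (h : ∀ v : s, F v = F' (ψ v)) : ∑' v, F v = ∑' w, F' w := by
  rw [← tsum_subtype_eq_of_support_subset hF, ← tsum_subtype_eq_of_support_subset hF',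
    ← ψ.tsum_eq]
  exact tsum_congr h

open Classical in
-- In this form the degree no longer appears: a boundary vertex may lose neighbours in an induced
-- subgraph, but the lost terms vanish when `f` is zero at both ends.
theorem lapFun_eq_tsum {V : Type*} {G : SimpleGraph V} {d : ℕ} (hG : DegreeLE G d) (f : V → ℂ)
    (x : V) : lapFun hG f x = ∑' y, if G.Adj x y then f x - f y else 0 := by
  rw [tsum_eq_sum (s := hG.nbrs x) fun y hy => if_neg fun h => hy (hG.mem_nbrs.2 h),
    Finset.sum_congr rfl fun y hy => if_pos (hG.mem_nbrs.1 hy), lapFun, Finset.sum_sub_distrib,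
    Finset.sum_const, nsmul_eq_mul]

theorem residual_eq_zero {V : Type*} {G : SimpleGraph V} {d : ℕ} (hG : DegreeLE G d) (μ : ℂ)
    {f : V → ℂ} {x : V} (hx : f x = 0) (h : ∀ y, G.Adj x y → f y = 0) :
    residual hG μ f x = 0 := by
  simp [residual, lapFun, hx, Finset.sum_eq_zero fun y hy => h y (hG.mem_nbrs.1 hy)]

section Transfer

variable {V W : Type*} {G : SimpleGraph V} {H : SimpleGraph W} {d : ℕ} {s : Set V} {t : Set W}
  {f : V → ℂ} {f' : W → ℂ}

/-- The Laplacians of functions that correspond to each other under an isomorphism between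
induced subgraphs, and whose supports have their neighbours in these subgraphs, correspond. -/
theorem lapFun_eq_of_iso (hG : DegreeLE G d) (hH : DegreeLE H d)
    (ψ : G.induce s ≃g H.induce t) (hff' : ∀ v : s, f v = f' (ψ v))
    (hf : ∀ v, f v ≠ 0 → v ∈ s ∧ ∀ y, G.Adj v y → y ∈ s)
    (hf' : ∀ w, f' w ≠ 0 → w ∈ t ∧ ∀ y, H.Adj w y → y ∈ t) (v : s) :
    lapFun hG f v = lapFun hH f' (ψ v) := by
  classical
  rw [lapFun_eq_tsum, lapFun_eq_tsum]
  refine tsum_eq_tsum_of_equiv ψ.toEquiv ?_ ?_ fun y => ?_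
  · intro y hy
    rw [Function.mem_support, ite_ne_right_iff] at hy
    by_cases h : f y = 0
    · exact (hf v fun h0 => hy.2 (by rw [h, h0, sub_zero])).2 y hy.1
    · exact (hf y h).1
  · intro y hy
    rw [Function.mem_support, ite_ne_right_iff] at hy
    by_cases h : f' y = 0
    · exact (hf' _ fun h0 => hy.2 (by rw [h, h0, sub_zero])).2 y hy.1
    · exact (hf' y h).1
  · have hadj : G.Adj v y ↔ H.Adj (ψ v) (ψ y) := (ψ.map_adj_iff (v := v) (w := y)).symm
    change _ = if H.Adj (ψ v) (ψ y) then f' (ψ v) - f' (ψ y) else 0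
    rw [← hff', ← hff']
    simp only [hadj]

theorem energy_eq_of_iso (ψ : s ≃ t) (hff' : ∀ v : s, f v = f' (ψ v))
    (hf : ∀ v, f v ≠ 0 → v ∈ s) (hf' : ∀ w, f' w ≠ 0 → w ∈ t) : energy f = energy f' := by
  refine tsum_eq_tsum_of_equiv ψ (fun v hv => hf v ?_) (fun w hw => hf' w ?_) fun v => ?_
  · rintro h
    simp [h] at hv
  · rintro h
    simp [h] at hw
  · rw [hff' v]

theorem energy_residual_eq_of_iso (hG : DegreeLE G d) (hH : DegreeLE H d) (μ : ℂ)
    (ψ : G.induce s ≃g H.induce t) (hff' : ∀ v : s, f v = f' (ψ v))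
    (hf : ∀ v, f v ≠ 0 → v ∈ s ∧ ∀ y, G.Adj v y → y ∈ s)
    (hf' : ∀ w, f' w ≠ 0 → w ∈ t ∧ ∀ y, H.Adj w y → y ∈ t) :
    energy (residual hG μ f) = energy (residual hH μ f') := by
  refine energy_eq_of_iso ψ.toEquiv (fun v => ?_) (fun v hv => ?_) fun w hw => ?_
  · exact congrArg₂ (· - ·) (lapFun_eq_of_iso hG hH ψ hff' hf hf' v)
      (congrArg (μ * ·) (hff' v))
  · by_contra hvs
    refine hv (residual_eq_zero hG μ ?_ fun y hy => ?_)
    · exact by_contra fun h => hvs (hf v h).1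
    · exact by_contra fun h => hvs ((hf y h).2 v hy.symm)
  · by_contra hwt
    refine hw (residual_eq_zero hH μ ?_ fun y hy => ?_)
    · exact by_contra fun h => hwt (hf' w h).1
    · exact by_contra fun h => hwt ((hf' y h).2 w hy.symm)

end Transfer

/-- The extra layer in radius `R + 1` contains every neighbour of the support, which is all that the
Laplacian sees. -/
theorem HasLocalEigenvector.of_rootedIso {V W : Type*} {G : SimpleGraph V} {H : SimpleGraph W}
    {d : ℕ} {hG : DegreeLE G d} (hH : DegreeLE H d) {μ : ℂ} {η : ℝ≥0∞} {R : ℕ} {x : V} {y : W}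
    (h : HasLocalEigenvector hG μ η R x)
    (hiso : RootedIso (G.induce (closedBall G x (R + 1))) ⟨x, self_mem_closedBall G x (R + 1)⟩
      (H.induce (closedBall H y (R + 1))) ⟨y, self_mem_closedBall H y (R + 1)⟩) :
    HasLocalEigenvector hH μ η R y := by
  classical
  obtain ⟨f, hf, hlt⟩ := h
  obtain ⟨ψ, hψ⟩ := hiso
  let f' : W → ℂ := fun w =>
    if h : w ∈ closedBall H y (R + 1) then f (ψ.symm ⟨w, h⟩) else 0
  have hff' : ∀ v : closedBall G x (R + 1), f v = f' (ψ v) := fun v => by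
    simp [f']
  have hf' : ∀ w, f' w ≠ 0 → w ∈ closedBall H y R := by
    intro w hw
    by_cases hwt : w ∈ closedBall H y (R + 1)
    · simp only [f', dif_pos hwt] at hw
      -- Distances to the root are realized inside the ball, carried over by `ψ`, and not increased
      -- by the inclusion into `H`.
      have h1 := mem_closedBall_map ψ.toHom (mem_closedBall_induce (Nat.le_succ R) (hf _ hw))
      have h2 := mem_closedBall_map (SimpleGraph.Embedding.induce _).toHom h1
      have h3 : ψ.toHom (ψ.symm ⟨w, hwt⟩) = ⟨w, hwt⟩ := ψ.apply_symm_apply _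
      have h4 : ψ.toHom ⟨x, self_mem_closedBall G x (R + 1)⟩ = _ := hψ
      rw [h3, h4] at h2
      exact h2
    · simp [f', hwt] at hw
  have hs := fun v hv => closedBall_succ_of_mem (hf v hv)
  have ht := fun w hw => closedBall_succ_of_mem (hf' w hw)
  refine ⟨f', hf', ?_⟩
  rwa [← energy_residual_eq_of_iso hG hH μ ψ hff' hs ht,
    ← energy_eq_of_iso ψ.toEquiv hff' (fun v hv => (hs v hv).1) fun w hw => (ht w hw).1]

theorem RootedIso.symm {V W : Type*} {G : SimpleGraph V} {x : V} {H : SimpleGraph W} {y : W}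
    (h : RootedIso G x H y) : RootedIso H y G x := by
  obtain ⟨φ, rfl⟩ := h
  exact ⟨φ.symm, φ.symm_apply_apply x⟩

theorem RootedIso.trans {U V W : Type*} {F : SimpleGraph U} {u : U} {G : SimpleGraph V} {x : V}
    {H : SimpleGraph W} {y : W} (h : RootedIso F u G x) (h' : RootedIso G x H y) :
    RootedIso F u H y := by
  obtain ⟨φ, rfl⟩ := h
  obtain ⟨ψ, rfl⟩ := h'
  exact ⟨φ.trans ψ, rfl⟩

/-- Spectral points with localized approximate eigenvectors are seen by every graph in which the
same balls occur. -/
theorem HasLocalEigenvector.exists_mem_lapSpectrum_of_occursIn {V W : Type*} {G : SimpleGraph V}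
    {H : SimpleGraph W} {d : ℕ} {hG : DegreeLE G d} (hH : DegreeLE H d) {μ : ℂ} {ε : ℝ}
    (hε : 0 < ε) {R : ℕ} {x : V} (h : HasLocalEigenvector hG μ (ENNReal.ofReal (ε ^ 2)) R x)
    (hGH : ∀ B : BallModel d, B.radius = R + 1 → B.OccursIn G → B.OccursIn H) :
    ∃ ν ∈ lapSpectrum hH, dist μ ν ≤ ε := by
  obtain ⟨B, hB, hiso⟩ := exists_ballModel hG x (R + 1)
  obtain ⟨y, hy⟩ := (BallModel.occursIn_iff hB).1
    (hGH B hB ((BallModel.occursIn_iff hB).2 ⟨x, hiso⟩))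
  exact (h.of_rootedIso hH (hiso.symm.trans hy)).exists_mem_lapSpectrum hε

end BoundedDegree

theorem theorem5 (d : ℕ)
    -- an enumeration of the rooted balls, which fixes the neighborhood distance
    (e : ℕ ≃ BoundedDegree.RootedBall d)
    -- the sequence of countable graphs of vertex degree bound `d`
    {V : ℕ → Type*} [∀ n, Countable (V n)] (G : ∀ n, SimpleGraph (V n))
    (hG : ∀ n, BoundedDegree.DegreeLE (G n) d)
    -- the limit graph
    {W : Type*} [Countable W] (H : SimpleGraph W) (hH : BoundedDegree.DegreeLE H d)
    (hA : BoundedDegree.FamilyPropertyA G)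
    (hlim : Tendsto (fun n => BoundedDegree.neighborhoodDist e (G n) H) atTop (𝓝 0)) :
    Tendsto
      (fun n => Metric.hausdorffEDist
        (BoundedDegree.lapSpectrum (hG n)) (BoundedDegree.lapSpectrum hH))
      atTop (𝓝 0) := by
  rw [ENNReal.tendsto_nhds_zero]
  intro ε' hε'
  obtain ⟨ε, hε, hεε'⟩ : ∃ ε : ℝ, 0 < ε ∧ ENNReal.ofReal ε ≤ ε' := by
    rcases eq_or_ne ε' ∞ with rfl | htop
    · exact ⟨1, one_pos, le_top⟩
    · exact ⟨ε'.toReal, ENNReal.toReal_pos hε'.ne' htop, ENNReal.ofReal_toReal_le⟩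
  obtain ⟨R, hR⟩ := hA.exists_hasLocalEigenvector hG hε
  have hcomp : IsCompact (BoundedDegree.lapSpectrum hH) := spectrum.isCompact _
  -- `H` has no uniform localization radius at hand, so only a finite `ε / 2`-net of its spectrum is
  -- transplanted, each point with error `ε / 2`.
  obtain ⟨t, hts, htfin, hcov⟩ := hcomp.finite_cover_balls (half_pos hε)
  have hloc : ∀ ν ∈ t, ∀ᶠ n in atTop, ∃ μ ∈ BoundedDegree.lapSpectrum (hG n),
      dist ν μ ≤ ε / 2 := by
    intro ν hν
    obtain ⟨S, y, hy⟩ := BoundedDegree.exists_hasLocalEigenvector (hts hν) (half_pos hε)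
    filter_upwards [BoundedDegree.eventually_occursIn_iff hlim (S + 1)] with n hn
    exact hy.exists_mem_lapSpectrum_of_occursIn (hG n) (half_pos hε) fun B hB => (hn B hB).2
  filter_upwards [BoundedDegree.eventually_occursIn_iff hlim (R + 1),
    (htfin.eventually_all).2 hloc] with n hn hn'
  refine (Metric.hausdorffEDist_le_of_mem_edist (fun μ hμ => ?_) fun ν hν => ?_).trans hεε'
  · obtain ⟨x, hx⟩ := hR n μ hμ
    obtain ⟨ν, hν, hd⟩ :=
      hx.exists_mem_lapSpectrum_of_occursIn hH hε fun B hB => (hn B hB).1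
    exact ⟨ν, hν, (edist_le_ofReal hε.le).2 hd⟩
  · obtain ⟨ν', hν', hd⟩ := Set.mem_iUnion₂.1 (hcov hν)
    obtain ⟨μ, hμ, hd'⟩ := hn' ν' hν'
    refine ⟨μ, hμ, (edist_le_ofReal hε.le).2 ?_⟩
    have := dist_triangle ν ν' μ
    rw [Metric.mem_ball] at hd
    linarith
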